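/- Let $U\subseteq\mathbb{R}^4$ be open and let $\Pi$ be a smooth rank-$2$ distribution on $U$, i.e. a smooth assignment of a $2$-plane $\Pi_x\subset T_x\mathbb{R}^4$ to every $x\in U$. Define its derivatives on the level of local smooth sections by $\partial^{(0)}\Pi=\Pi$ and $\partial^{(k+1)}\Pi=\partial^{(k)}\Pi+[\Pi,\partial^{(k)}\Pi]$, and let $(\partial^{(k)}\Pi)_x$ be the space of values at $x$ of the sections of $\partial^{(k)}\Pi$. Assume that $\Pi$ is locally regular: every point of $U$ has a neighbourhood on which, for every $k$, the dimension of $(\partial^{(k)}\Pi)_x$ is constant. Then every point $p\in U$ has an open neighbourhood $V\subseteq U$ carrying a smooth almost complex structure $j$ (a smooth field of endomorphisms of the tangent spaces with $j^2=-1$) such that $$\Pi_x=\operatorname{Im}(N_j)_x=\{N_j(\xi,\eta):\xi,\eta\in T_x\mathbb{R}^4\}\qquad\text{for all }x\in V,$$ where $N_j(\xi,\eta)=[j\xi,j\eta]-j[j\xi,\eta]-j[\xi,j\eta]-[\xi,\eta]$ is the Nijenhuis tensor of $j$ (evaluated on arbitrary vector fields extending the given vectors). -/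

import Mathlib

open scoped ContDiff Topology

noncomputable section

variable {E : Type*} [NormedAddCommGroup E] [NormedSpace ℝ E]

/-- `D` is a smooth distribution of rank `r` on the set `U` (a smooth section over `U` of the
Grassmann bundle of `r`-planes): near every point of `U` it has a smooth local frame. -/
def IsSmoothDistributionOn (r : ℕ) (D : E → Submodule ℝ E) (U : Set E) : Prop :=
  ∀ p ∈ U, ∃ V : Set E, IsOpen V ∧ p ∈ V ∧ V ⊆ U ∧ ∃ ξ : Fin r → E → E,
    (∀ i, ContDiffOn ℝ ∞ (ξ i) V) ∧
    ∀ x ∈ V, LinearIndependent ℝ (fun i => ξ i x) ∧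
      Submodule.span ℝ (Set.range fun i => ξ i x) = D x

/-- The local sections of `D` near `x`: vector fields that on some neighbourhood of `x` are smooth
and take values in `D`. -/
def localSections (D : E → Submodule ℝ E) (x : E) : Submodule ℝ (E → E) where
  carrier := {X | ∀ᶠ y in 𝓝 x, ContDiffAt ℝ ∞ X y ∧ X y ∈ D y}
  zero_mem' := Filter.Eventually.of_forall fun y => ⟨contDiffAt_const, (D y).zero_mem⟩
  add_mem' := by
    intro X Y hX hY
    filter_upwards [hX, hY] with y h1 h2
    exact ⟨h1.1.add h2.1, (D y).add_mem h1.2 h2.2⟩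
  smul_mem' := by
    intro c X hX
    filter_upwards [hX] with y h
    exact ⟨contDiffAt_const.smul h.1, (D y).smul_mem c h.2⟩

/-- Local sections near `x` of the `k`-th derivative `∂⁽ᵏ⁾D` of the distribution:
`∂⁽⁰⁾D = D` and `∂⁽ᵏ⁺¹⁾D = ∂⁽ᵏ⁾D + [D, ∂⁽ᵏ⁾D]` on the level of sections. -/
def derivedSections (D : E → Submodule ℝ E) (x : E) : ℕ → Submodule ℝ (E → E)
  | 0 => localSections D x
  | k + 1 => derivedSections D x k ⊔
      Submodule.span ℝ {Z | ∃ X ∈ localSections D x, ∃ Y ∈ derivedSections D x k,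
        Z = VectorField.lieBracket ℝ X Y}

/-- The subspace `(∂⁽ᵏ⁾D)ₓ` of values at `x` of the sections of the `k`-th derivative of `D`. -/
def derivedFlag (D : E → Submodule ℝ E) (k : ℕ) (x : E) : Submodule ℝ E :=
  (derivedSections D x k).map (LinearMap.proj x)

/-- `D` is (locally) regular on `U`: near every point of `U` all the derivatives of `D` have
constant dimension, i.e. the gradations of the Tanaka invariant have stable dimensions. -/
def IsRegularDistributionOn (D : E → Submodule ℝ E) (U : Set E) : Prop :=
  ∀ p ∈ U, ∃ V : Set E, IsOpen V ∧ p ∈ V ∧ V ⊆ U ∧ ∀ k : ℕ, ∀ x ∈ V,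
    Module.finrank ℝ (derivedFlag D k x) = Module.finrank ℝ (derivedFlag D k p)

/-- `j` is a smooth almost complex structure on `V`. -/
def IsAlmostComplexOn (j : E → E →L[ℝ] E) (V : Set E) : Prop :=
  ContDiffOn ℝ ∞ j V ∧ ∀ x ∈ V, ∀ v, j x (j x v) = -v

/-- `[jX, jY] - j[jX, Y] - j[X, jY] - [X, Y]` for vector fields `X`, `Y`. -/
def nijenhuisBracket (j : E → E →L[ℝ] E) (X Y : E → E) (x : E) : E :=
  VectorField.lieBracket ℝ (fun y => j y (X y)) (fun y => j y (Y y)) x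
    - j x (VectorField.lieBracket ℝ (fun y => j y (X y)) Y x)
    - j x (VectorField.lieBracket ℝ X (fun y => j y (Y y)) x)
    - VectorField.lieBracket ℝ X Y x

/-- The Nijenhuis tensor `N_j` at `x` on the vectors `u`, `v`, computed with their constant
prolongations; by `nijenhuisBracket_eq_nijenhuis` any other prolongations give the same value. -/
def nijenhuis (j : E → E →L[ℝ] E) (x u v : E) : E :=
  nijenhuisBracket j (fun _ => u) (fun _ => v) x

theorem nijenhuisBracket_eq_nijenhuis {j : E → E →L[ℝ] E} {X Y : E → E} {x : E}
    (hj : DifferentiableAt ℝ j x) (hjj : ∀ v, j x (j x v) = -v)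
    (hX : DifferentiableAt ℝ X x) (hY : DifferentiableAt ℝ Y x) :
    nijenhuisBracket j X Y x = nijenhuis j x (X x) (Y x) := by
  have key : ∀ Z : E → E, DifferentiableAt ℝ Z x → ∀ w,
      fderiv ℝ (fun y => j y (Z y)) x w = fderiv ℝ j x w (Z x) + j x (fderiv ℝ Z x w) := by
    intro Z hZ w
    have h := (hj.hasFDerivAt.clm_apply hZ.hasFDerivAt).fderiv
    rw [h]
    simp [add_comm]
  have hc : ∀ w : E, DifferentiableAt ℝ (fun _ : E => w) x := fun w =>
    differentiableAt_const w
  simp only [nijenhuis, nijenhuisBracket, VectorField.lieBracket, key X hX, key Y hY,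
    key _ (hc _), map_sub, map_add, hjj, fderiv_fun_const, Pi.zero_apply,
    zero_apply, map_zero]
  abel

/-- The image `Im (N_j)ₓ`. -/
def nijenhuisImage (j : E → E →L[ℝ] E) (x : E) : Set E :=
  {w | ∃ u v : E, nijenhuis j x u v = w}

end

noncomputable section

variable {E : Type*} [NormedAddCommGroup E] [NormedSpace ℝ E]
variable {F : Type*} [NormedAddCommGroup F] [NormedSpace ℝ F]
variable {G : Type*} [NormedAddCommGroup G] [NormedSpace ℝ G]

/-! The structure j is sought through a frame with j e₀ = e₁, j e₂ = e₃ and e₀, e₁ spanning Π. Since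
N is antisymmetric and j-antilinear in each argument, it is determined by N(e₀, e₂) = -T, with T =
`frameTorsion e`, and its image is the complex line through T when T ≠ 0. So it suffices that T be a
nonvanishing section of Π (`exists_almostComplex_of_frame`).

Fix a frame X with X₀, X₁ spanning Π. For the frames `adaptedFrame X a b u v`, the condition that T
lie in Π is one complex equation, (i - a)(σ₀ + v s) = b(σ₁ - u s), where σₖ = `slopeRe X k` + i
`slopeIm X k` and s is the class of [X₀, X₁] modulo Π, with X₂, X₃ read as 1, i
(`frameTorsion_adaptedFrame_mem`).

If [X₀, X₁] is not in Π at p, take it as X₂. Then s = 1, and with b = 1 the equation is solved by u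
and v for every a. Otherwise regularity makes Π involutive near p, so s = 0 and u, v are free; the
equation determines a and b once σ₀, σ₁ are independent over ℝ, which a choice of the 1-jet of X₃ at
p achieves.

Either way a free function remains. Changing it by a function that vanishes at p changes T(p) by a
nonzero vector (`frameTorsion_perturb`), so T(p) ≠ 0 for one of the two choices. -/

/-- `f` is smooth on a neighbourhood of `p`. -/
def SmoothNear (f : E → F) (p : E) : Prop := ∀ᶠ x in 𝓝 p, ContDiffAt ℝ ∞ f x

/-! ### Calculus of maps smooth near a point -/

namespace SmoothNear

variable {p : E} {f g : E → F}

theorem contDiffAt (h : SmoothNear f p) : ContDiffAt ℝ ∞ f p := h.self_of_nhds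

theorem continuousAt (h : SmoothNear f p) : ContinuousAt f p := h.contDiffAt.continuousAt

theorem differentiableAt (h : SmoothNear f p) : DifferentiableAt ℝ f p :=
  h.contDiffAt.differentiableAt (by simp)

theorem eventually (h : SmoothNear f p) : ∀ᶠ x in 𝓝 p, SmoothNear f x :=
  eventually_eventually_nhds.2 h

theorem eventually_differentiableAt (h : SmoothNear f p) :
    ∀ᶠ x in 𝓝 p, DifferentiableAt ℝ f x :=
  h.eventually.mono fun _ hx => hx.differentiableAt

theorem const (c : F) : SmoothNear (fun _ : E => c) p :=
  Filter.Eventually.of_forall fun _ => contDiffAt_const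

theorem of_contDiff (h : ContDiff ℝ ∞ f) : SmoothNear f p :=
  Filter.Eventually.of_forall fun _ => h.contDiffAt

theorem add (hf : SmoothNear f p) (hg : SmoothNear g p) :
    SmoothNear (fun x => f x + g x) p := by
  filter_upwards [hf, hg] with x h1 h2 using h1.add h2

theorem sub (hf : SmoothNear f p) (hg : SmoothNear g p) :
    SmoothNear (fun x => f x - g x) p := by
  filter_upwards [hf, hg] with x h1 h2 using h1.sub h2

theorem neg (hf : SmoothNear f p) : SmoothNear (fun x => -f x) p := by
  filter_upwards [hf] with x h1 using h1.neg

theorem smul {a : E → ℝ} (ha : SmoothNear a p) (hf : SmoothNear f p) :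
    SmoothNear (fun x => a x • f x) p := by
  filter_upwards [ha, hf] with x h1 h2 using h1.smul h2

theorem mul {a b : E → ℝ} (ha : SmoothNear a p) (hb : SmoothNear b p) :
    SmoothNear (fun x => a x * b x) p := by
  filter_upwards [ha, hb] with x h1 h2 using h1.mul h2

theorem div {a b : E → ℝ} (ha : SmoothNear a p) (hb : SmoothNear b p) (h0 : b p ≠ 0) :
    SmoothNear (fun x => a x / b x) p := by
  filter_upwards [ha, hb, hb.continuousAt.eventually_ne h0] with x h1 h2 h3 using h1.div h2 h3

theorem clm_apply {A : E → F →L[ℝ] G} (hA : SmoothNear A p) (hf : SmoothNear f p) :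
    SmoothNear (fun x => A x (f x)) p := by
  filter_upwards [hA, hf] with x h1 h2 using h1.clm_apply h2

theorem proj {ι : Type*} [Fintype ι] {a : E → ι → ℝ} (ha : SmoothNear a p) (i : ι) :
    SmoothNear (fun x => a x i) p := by
  filter_upwards [ha] with x h1 using contDiffAt_pi.1 h1 i

theorem lieBracket {X Y : E → E} (hX : SmoothNear X p) (hY : SmoothNear Y p) :
    SmoothNear (VectorField.lieBracket ℝ X Y) p := by
  filter_upwards [hX, hY] with x h1 h2 using h1.lieBracket_vectorField h2 (by simp)

end SmoothNear

/-! ### Frames and coframes -/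

/-- The linear map `ℝ⁴ → E` sending the standard basis to the vectors `e i x`. -/
def frameMap (e : Fin 4 → E → E) (x : E) : (Fin 4 → ℝ) →L[ℝ] E :=
  ∑ i, (ContinuousLinearMap.proj (R := ℝ) (φ := fun _ : Fin 4 => ℝ) i).smulRight (e i x)

theorem frameMap_apply (e : Fin 4 → E → E) (x : E) (c : Fin 4 → ℝ) :
    frameMap e x c = ∑ i, c i • e i x := by
  simp [frameMap]

/-- The vectors `e i x` form a basis of `E`. -/
def IsFrameAt (e : Fin 4 → E → E) (x : E) : Prop := (frameMap e x).IsInvertible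

/-- The coordinates of a vector in the frame `e` at `x`. -/
def coframe (e : Fin 4 → E → E) (x : E) : E →L[ℝ] (Fin 4 → ℝ) := (frameMap e x).inverse

variable {e : Fin 4 → E → E} {p x : E}

theorem IsFrameAt.of_linearIndependent (hE : Module.finrank ℝ E = 4)
    (h : LinearIndependent ℝ fun i => e i x) : IsFrameAt e x := by
  have : FiniteDimensional ℝ E := Module.finite_of_finrank_pos (by omega)
  let b := basisOfLinearIndependentOfCardEqFinrank h (by simp [hE])
  refine ⟨b.equivFun.symm.toContinuousLinearEquiv, ?_⟩
  ext1 c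
  simp [frameMap_apply, b, Module.Basis.equivFun_symm_apply]

theorem IsFrameAt.of_forall (hE : Module.finrank ℝ E = 4)
    (h : ∀ c : Fin 4 → ℝ, ∑ i, c i • e i x = 0 → c = 0) : IsFrameAt e x :=
  .of_linearIndependent hE <| Fintype.linearIndependent_iff.2 fun c hc i => congrFun (h c hc) i

theorem IsFrameAt.coframe_frameMap (h : IsFrameAt e x) (c : Fin 4 → ℝ) :
    coframe e x (frameMap e x c) = c := by
  obtain ⟨A, hA⟩ := h
  simp [coframe, ← hA]

theorem IsFrameAt.frameMap_coframe (h : IsFrameAt e x) (w : E) :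
    frameMap e x (coframe e x w) = w := by
  obtain ⟨A, hA⟩ := h
  simp [coframe, ← hA]

theorem IsFrameAt.sum_coframe (h : IsFrameAt e x) (w : E) :
    ∑ i, coframe e x w i • e i x = w := by
  rw [← frameMap_apply, h.frameMap_coframe]

theorem frameMap_single (e : Fin 4 → E → E) (x : E) (i : Fin 4) :
    frameMap e x (Pi.single i 1) = e i x := by
  simp [frameMap_apply, Pi.single_apply]

theorem IsFrameAt.coframe_frame (h : IsFrameAt e x) (i : Fin 4) :
    coframe e x (e i x) = Pi.single i 1 := by
  rw [← frameMap_single e x i, h.coframe_frameMap]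

theorem smoothNear_frameMap (he : ∀ i, SmoothNear (e i) p) : SmoothNear (frameMap e) p := by
  filter_upwards [Filter.eventually_all.2 he] with x hx
  unfold frameMap
  exact ContDiffAt.sum fun i _ => contDiffAt_const.smulRight (hx i)

theorem IsFrameAt.eventually (he : ∀ i, SmoothNear (e i) p) (h : IsFrameAt e p) :
    ∀ᶠ x in 𝓝 p, IsFrameAt e x := by
  obtain ⟨A, hA⟩ := h
  have h1 := ContinuousLinearEquiv.nhds A
  rw [hA] at h1
  exact (smoothNear_frameMap he).continuousAt h1

theorem smoothNear_coframe (he : ∀ i, SmoothNear (e i) p) (h : IsFrameAt e p) :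
    SmoothNear (coframe e) p := by
  filter_upwards [smoothNear_frameMap he, h.eventually he] with x h1 h2
  exact (h2.contDiffAt_map_inverse).comp x h1

theorem IsFrameAt.mem_span_iff (h : IsFrameAt e x) (w : E) :
    w ∈ Submodule.span ℝ {e 0 x, e 1 x} ↔ coframe e x w 2 = 0 ∧ coframe e x w 3 = 0 := by
  rw [Submodule.mem_span_pair]
  constructor
  · rintro ⟨a, b, rfl⟩
    simp [h.coframe_frame]
  · rintro ⟨h2, h3⟩
    refine ⟨coframe e x w 0, coframe e x w 1, ?_⟩
    conv_rhs => rw [← h.sum_coframe w]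
    simp [Fin.sum_univ_four, h2, h3]

/-! ### The almost complex structure of a frame -/

/-- Multiplication by `i` on `ℝ⁴ = ℂ²`. -/
def stdComplex : (Fin 4 → ℝ) →L[ℝ] (Fin 4 → ℝ) :=
  LinearMap.toContinuousLinearMap
    { toFun := fun c => ![-c 1, c 0, -c 3, c 2]
      map_add' := fun a b => by ext i; fin_cases i <;> simp [add_comm]
      map_smul' := fun a b => by ext i; fin_cases i <;> simp }

theorem stdComplex_apply (c : Fin 4 → ℝ) : stdComplex c = ![-c 1, c 0, -c 3, c 2] := rfl

/-- The almost complex structure with `e 0 ↦ e 1` and `e 2 ↦ e 3`. -/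
def frameComplex (e : Fin 4 → E → E) (x : E) : E →L[ℝ] E :=
  (frameMap e x).comp (stdComplex.comp (coframe e x))

theorem IsFrameAt.frameComplex_apply (h : IsFrameAt e x) (w : E) :
    coframe e x (frameComplex e x w) = stdComplex (coframe e x w) := by
  simp [frameComplex, h.coframe_frameMap]

theorem frameComplex_eq (e : Fin 4 → E → E) (x w : E) :
    frameComplex e x w = -coframe e x w 1 • e 0 x + coframe e x w 0 • e 1 x
      - coframe e x w 3 • e 2 x + coframe e x w 2 • e 3 x := by
  simp [frameComplex, frameMap_apply, stdComplex_apply, Fin.sum_univ_four, sub_eq_add_neg]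

theorem IsFrameAt.frameComplex_frame (h : IsFrameAt e x) :
    frameComplex e x (e 0 x) = e 1 x ∧ frameComplex e x (e 1 x) = -e 0 x ∧
      frameComplex e x (e 2 x) = e 3 x ∧ frameComplex e x (e 3 x) = -e 2 x := by
  simp [frameComplex_eq, h.coframe_frame]

theorem IsFrameAt.frameComplex_sq (h : IsFrameAt e x) (w : E) :
    frameComplex e x (frameComplex e x w) = -w := by
  have h1 : stdComplex (stdComplex (coframe e x w)) = -coframe e x w := by
    ext i; fin_cases i <;> simp [stdComplex_apply]
  have h2 := h.frameComplex_apply (frameComplex e x w)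
  rw [h.frameComplex_apply w, h1, ← map_neg] at h2
  rw [← h.frameMap_coframe (frameComplex e x (frameComplex e x w)), h2, h.frameMap_coframe]

theorem smoothNear_frameComplex (he : ∀ i, SmoothNear (e i) p) (h : IsFrameAt e p) :
    SmoothNear (frameComplex e) p := by
  filter_upwards [smoothNear_frameMap he, smoothNear_coframe he h] with x h1 h2
  exact h1.clm_comp (contDiffAt_const.clm_comp h2)

/-! ### The Nijenhuis tensor -/

variable {j : E → E →L[ℝ] E}

theorem nijenhuis_eq (hj : DifferentiableAt ℝ j x) (u v : E) :
    nijenhuis j x u v = fderiv ℝ j x (j x u) v - fderiv ℝ j x (j x v) u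
      + j x (fderiv ℝ j x v u) - j x (fderiv ℝ j x u v) := by
  have key : ∀ z w : E, fderiv ℝ (fun y => j y z) x w = fderiv ℝ j x w z := by
    intro z w
    rw [(hj.hasFDerivAt.clm_apply (hasFDerivAt_const z x)).fderiv]
    simp
  simp [nijenhuis, nijenhuisBracket, VectorField.lieBracket, key]

/-- Differentiating j² = -1 shows that every derivative of j anticommutes with j. -/
theorem fderiv_apply_complex (hj : DifferentiableAt ℝ j x)
    (hjj : ∀ᶠ y in 𝓝 x, ∀ v, j y (j y v) = -v) (w v : E) :
    fderiv ℝ j x w (j x v) = -j x (fderiv ℝ j x w v) := by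
  have h1 : HasFDerivAt (fun y => j y (j y v)) _ x :=
    hj.hasFDerivAt.clm_apply (hj.hasFDerivAt.clm_apply (hasFDerivAt_const v x))
  have h2 : HasFDerivAt (fun y => j y (j y v)) (0 : E →L[ℝ] E) x :=
    (hasFDerivAt_const (-v) x).congr_of_eventuallyEq (hjj.mono fun y hy => hy v)
  have h3 := congrArg (fun A : E →L[ℝ] E => A w) (h1.unique h2)
  simp at h3
  rw [add_comm] at h3
  exact eq_neg_of_add_eq_zero_left h3

theorem nijenhuis_complex_left (hj : DifferentiableAt ℝ j x)
    (hjj : ∀ᶠ y in 𝓝 x, ∀ v, j y (j y v) = -v) (u v : E) :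
    nijenhuis j x (j x u) v = -j x (nijenhuis j x u v) := by
  have h := hjj.self_of_nhds
  simp only [nijenhuis_eq hj, h, map_neg, map_add, map_sub, fderiv_apply_complex hj hjj,
    neg_apply]
  abel

theorem nijenhuis_swap (hj : DifferentiableAt ℝ j x) (u v : E) :
    nijenhuis j x u v = -nijenhuis j x v u := by
  simp only [nijenhuis_eq hj]
  abel

/-- The Nijenhuis tensor at a point as a bilinear map. -/
theorem exists_nijenhuis_bilin (hj : DifferentiableAt ℝ j x) :
    ∃ N : E →ₗ[ℝ] E →ₗ[ℝ] E, ∀ u v, N u v = nijenhuis j x u v := by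
  refine ⟨LinearMap.mk₂ ℝ (nijenhuis j x) ?_ ?_ ?_ ?_, fun u v => rfl⟩ <;> intros <;>
    simp only [nijenhuis_eq hj, map_add, map_smul, add_apply, smul_apply, smul_add, smul_sub] <;>
    abel

/-- Up to sign, the Nijenhuis tensor of `frameComplex e` on the vectors `e 0 x`, `e 2 x`. -/
def frameTorsion (e : Fin 4 → E → E) (x : E) : E :=
  VectorField.lieBracket ℝ (e 0) (e 2) x - VectorField.lieBracket ℝ (e 1) (e 3) x
    + frameComplex e x (VectorField.lieBracket ℝ (e 1) (e 2) x
      + VectorField.lieBracket ℝ (e 0) (e 3) x)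

theorem smoothNear_frameTorsion (he : ∀ i, SmoothNear (e i) p) (h : IsFrameAt e p) :
    SmoothNear (frameTorsion e) p :=
  (((he 0).lieBracket (he 2)).sub ((he 1).lieBracket (he 3))).add
    ((smoothNear_frameComplex he h).clm_apply
      (((he 1).lieBracket (he 2)).add ((he 0).lieBracket (he 3))))

/-- By tensoriality the frame fields can replace the constant prolongations; j then maps them to
frame fields again, and only brackets of the frame remain. -/
theorem nijenhuis_frame (he : ∀ i, SmoothNear (e i) x) (h : IsFrameAt e x) :
    nijenhuis (frameComplex e) x (e 0 x) (e 2 x) = -frameTorsion e x := by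
  have hev := h.eventually he
  have h1 : (fun y => frameComplex e y (e 0 y)) =ᶠ[𝓝 x] e 1 :=
    hev.mono fun y hy => hy.frameComplex_frame.1
  have h3 : (fun y => frameComplex e y (e 2 y)) =ᶠ[𝓝 x] e 3 :=
    hev.mono fun y hy => hy.frameComplex_frame.2.2.1
  rw [← nijenhuisBracket_eq_nijenhuis (smoothNear_frameComplex he h).differentiableAt
    h.frameComplex_sq (he 0).differentiableAt (he 2).differentiableAt]
  have e2 : e 2 =ᶠ[𝓝 x] e 2 := Filter.EventuallyEq.rfl
  have e0 : e 0 =ᶠ[𝓝 x] e 0 := Filter.EventuallyEq.rfl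
  simp only [nijenhuisBracket, frameTorsion, h1.lieBracket_vectorField_eq h3,
    h1.lieBracket_vectorField_eq e2, e0.lieBracket_vectorField_eq h3, map_add]
  abel

/-- Antilinearity expresses N on all pairs of frame vectors through ±T and ±jT, and kills it on the
complex-dependent pairs (e₀, e₁) and (e₂, e₃). The values lie in the complex line of T, which is the
span of e₀, e₁. -/
theorem nijenhuisImage_frame (he : ∀ i, SmoothNear (e i) x) (h : IsFrameAt e x)
    (hF : frameTorsion e x ∈ Submodule.span ℝ {e 0 x, e 1 x}) (h0 : frameTorsion e x ≠ 0) :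
    nijenhuisImage (frameComplex e) x = Submodule.span ℝ {e 0 x, e 1 x} := by
  set S := Submodule.span ℝ {e 0 x, e 1 x}
  set j := frameComplex e
  have hj : DifferentiableAt ℝ j x := (smoothNear_frameComplex he h).differentiableAt
  have hjj : ∀ᶠ y in 𝓝 x, ∀ v, j y (j y v) = -v :=
    (h.eventually he).mono fun y hy => hy.frameComplex_sq
  obtain ⟨j0, j1, j2, j3⟩ := h.frameComplex_frame
  obtain ⟨N, hN⟩ := exists_nijenhuis_bilin hj
  have hNj : ∀ u v, N (j x u) v = -j x (N u v) := by
    intro u v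
    simp only [hN, nijenhuis_complex_left hj hjj]
  have hsw : ∀ u v, N u v = -N v u := by
    intro u v
    simp only [hN]
    exact nijenhuis_swap hj u v
  have hNj' : ∀ u v, N u (j x v) = -j x (N u v) := by
    intro u v
    rw [hsw, hNj, hsw v u, map_neg, neg_neg]
  have hself : ∀ u, N u u = 0 := fun u => by
    have h2 : (2 : ℝ) • N u u = 0 := by
      rw [two_smul]
      exact add_eq_zero_iff_eq_neg.2 (hsw u u)
    exact (smul_eq_zero_iff_right two_ne_zero).1 h2
  have h02 : N (e 0 x) (e 2 x) = -frameTorsion e x := by rw [hN, nijenhuis_frame he h]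
  have hjS : ∀ w ∈ S, j x w ∈ S := by
    intro w hw
    obtain ⟨a, b, rfl⟩ := Submodule.mem_span_pair.1 hw
    rw [map_add, map_smul, map_smul, j0, j1]
    exact S.add_mem (S.smul_mem _ (Submodule.subset_span (by simp)))
      (S.smul_mem _ (S.neg_mem (Submodule.subset_span (by simp))))
  have h12 : N (e 1 x) (e 2 x) = j x (frameTorsion e x) := by
    rw [← j0, hNj, h02, map_neg, neg_neg]
  have h03 : N (e 0 x) (e 3 x) = j x (frameTorsion e x) := by
    rw [← j2, hNj', h02, map_neg, neg_neg]
  have h13 : N (e 1 x) (e 3 x) = frameTorsion e x := by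
    rw [← j2, hNj', h12, h.frameComplex_sq, neg_neg]
  have h01 : N (e 0 x) (e 1 x) = 0 := by rw [← j0, hNj', hself, map_zero, neg_zero]
  have h23 : N (e 2 x) (e 3 x) = 0 := by rw [← j2, hNj', hself, map_zero, neg_zero]
  have hframe : ∀ a b : Fin 4, N (e a x) (e b x) ∈ S := by
    have hlt : ∀ a b : Fin 4, a < b → N (e a x) (e b x) ∈ S := by
      intro a b hab
      have hT := hjS _ hF
      fin_cases a <;> fin_cases b <;> simp at hab <;>
        simp only [Fin.zero_eta, Fin.mk_one, Fin.reduceFinMk, h01, h02, h03, h12, h13, h23,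
          S.zero_mem, S.neg_mem_iff, hF, hT]
    intro a b
    rcases lt_trichotomy a b with hab | rfl | hab
    · exact hlt a b hab
    · rw [hself]; exact S.zero_mem
    · rw [hsw]; exact S.neg_mem (hlt b a hab)
  ext w
  simp only [nijenhuisImage, Set.mem_ofPred_eq, SetLike.mem_coe]
  constructor
  · rintro ⟨u, v, rfl⟩
    rw [← hN, ← h.sum_coframe u, ← h.sum_coframe v]
    simp only [map_sum, map_smul, LinearMap.sum_apply, LinearMap.smul_apply]
    exact S.sum_mem fun a _ => S.smul_mem _ <| S.sum_mem fun b _ => S.smul_mem _ (hframe _ _)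
  · intro hw
    obtain ⟨a, b, rfl⟩ := Submodule.mem_span_pair.1 hw
    obtain ⟨f, g, hfg⟩ := Submodule.mem_span_pair.1 hF
    have hne : f ^ 2 + g ^ 2 ≠ 0 := by
      intro hz
      have hf : f = 0 := by nlinarith [sq_nonneg f, sq_nonneg g]
      have hg : g = 0 := by nlinarith [sq_nonneg f, sq_nonneg g]
      exact h0 (by rw [← hfg, hf, hg]; simp)
    -- Complex division: with T = f + ig, the first argument α e₀ + β e₁ must satisfy (-α + iβ)(f +
    -- ig) = a + ib.
    refine ⟨(-(a * f + b * g) / (f ^ 2 + g ^ 2)) • e 0 x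
      + ((b * f - a * g) / (f ^ 2 + g ^ 2)) • e 1 x, e 2 x, ?_⟩
    have hjF : j x (frameTorsion e x) = f • e 1 x + g • -e 0 x := by
      rw [← hfg, map_add, map_smul, map_smul, j0, j1]
    rw [← hN]
    simp only [map_add, map_smul, LinearMap.add_apply, LinearMap.smul_apply, h02, h12, hjF]
    rw [← hfg]
    match_scalars <;> field_simp <;> ring

/-- A frame whose torsion is a nonvanishing section of `span {e 0, e 1}` yields an almost complex
structure whose Nijenhuis tensor has this distribution as image. -/
theorem exists_almostComplex_of_frame {D : E → Submodule ℝ E} {U : Set E} (hU : IsOpen U)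
    (hp : p ∈ U) (he : ∀ i, SmoothNear (e i) p) (h : IsFrameAt e p)
    (hD : ∀ᶠ x in 𝓝 p, Submodule.span ℝ {e 0 x, e 1 x} = D x)
    (hF : ∀ᶠ x in 𝓝 p, frameTorsion e x ∈ D x) (h0 : frameTorsion e p ≠ 0) :
    ∃ V : Set E, IsOpen V ∧ p ∈ V ∧ V ⊆ U ∧ ∃ j : E → E →L[ℝ] E,
      IsAlmostComplexOn j V ∧ ∀ x ∈ V, nijenhuisImage j x = (D x : Set E) := by
  have hall : ∀ᶠ x in 𝓝 p, x ∈ U ∧ (∀ i, SmoothNear (e i) x) ∧ IsFrameAt e x ∧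
      Submodule.span ℝ {e 0 x, e 1 x} = D x ∧ frameTorsion e x ∈ D x ∧ frameTorsion e x ≠ 0 := by
    filter_upwards [hU.mem_nhds hp, Filter.eventually_all.2 fun i => (he i).eventually,
      h.eventually he, hD, hF,
      (smoothNear_frameTorsion he h).continuousAt.eventually_ne h0] with x h1 h2 h3 h4 h5 h6
    exact ⟨h1, h2, h3, h4, h5, h6⟩
  obtain ⟨V, hV, hVo, hpV⟩ := eventually_nhds_iff.1 hall
  refine ⟨V, hVo, hpV, fun x hx => (hV x hx).1, frameComplex e, ⟨?_, ?_⟩, ?_⟩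
  · intro x hx
    obtain ⟨-, h2, h3, -⟩ := hV x hx
    exact (smoothNear_frameComplex h2 h3).contDiffAt.contDiffWithinAt
  · intro x hx
    exact (hV x hx).2.2.1.frameComplex_sq
  · intro x hx
    obtain ⟨-, h2, h3, h4, h5, h6⟩ := hV x hx
    rw [nijenhuisImage_frame h2 h3 (h4 ▸ h5) h6, h4]

end

noncomputable section

variable {E : Type*} [NormedAddCommGroup E] [NormedSpace ℝ E]
variable {e : Fin 4 → E → E} {p x : E}

open VectorField

/-! ### Brackets of linear combinations -/

theorem lieBracket_combination_left {a b : E → ℝ} {X Y Z : E → E}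
    (ha : DifferentiableAt ℝ a x) (hb : DifferentiableAt ℝ b x)
    (hX : DifferentiableAt ℝ X x) (hY : DifferentiableAt ℝ Y x) :
    lieBracket ℝ (fun y => a y • X y + b y • Y y) Z x =
      -fderiv ℝ a x (Z x) • X x + a x • lieBracket ℝ X Z x
        + (-fderiv ℝ b x (Z x) • Y x + b x • lieBracket ℝ Y Z x) := by
  rw [← lieBracket_smul_left ha hX, ← lieBracket_smul_left hb hY]
  exact lieBracket_add_left (ha.smul hX) (hb.smul hY)

theorem lieBracket_combination_right {a b : E → ℝ} {X Y Z : E → E}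
    (ha : DifferentiableAt ℝ a x) (hb : DifferentiableAt ℝ b x)
    (hX : DifferentiableAt ℝ X x) (hY : DifferentiableAt ℝ Y x) :
    lieBracket ℝ Z (fun y => a y • X y + b y • Y y) x =
      fderiv ℝ a x (Z x) • X x + a x • lieBracket ℝ Z X x
        + (fderiv ℝ b x (Z x) • Y x + b x • lieBracket ℝ Z Y x) := by
  rw [← lieBracket_smul_right ha hX, ← lieBracket_smul_right hb hY]
  exact lieBracket_add_right (ha.smul hX) (hb.smul hY)

/-! ### Frames adapted to a distribution -/

theorem IsFrameAt.finrank_eq (h : IsFrameAt e x) : Module.finrank ℝ E = 4 := by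
  obtain ⟨A, -⟩ := h
  rw [← A.toLinearEquiv.finrank_eq]
  simp

theorem frameMap_congr {e' : Fin 4 → E → E} (h : ∀ i, e' i x = e i x) :
    frameMap e' x = frameMap e x := by
  simp [frameMap, h]

theorem coframe_congr {e' : Fin 4 → E → E} (h : ∀ i, e' i x = e i x) :
    coframe e' x = coframe e x := by
  rw [coframe, coframe, frameMap_congr h]

theorem frameComplex_congr {e' : Fin 4 → E → E} (h : ∀ i, e' i x = e i x) :
    frameComplex e' x = frameComplex e x := by
  rw [frameComplex, frameComplex, frameMap_congr h, coframe_congr h]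

/-- The change of the torsion at a point under a first order perturbation of a frame. -/
theorem frameTorsion_perturb {e' : Fin 4 → E → E} {l : E → ℝ} {A Y : E → E}
    (he1 : DifferentiableAt ℝ (e 1) x) (he3 : DifferentiableAt ℝ (e 3) x)
    (hl : DifferentiableAt ℝ l x) (hA : DifferentiableAt ℝ A x) (hY : DifferentiableAt ℝ Y x)
    (hlx : l x = 0) (h0 : e' 0 = e 0) (h1 : e' 1 = fun y => e 1 y + l y • A y)
    (h2 : e' 2 = e 2) (h3 : e' 3 = fun y => e 3 y + l y • Y y) :
    frameTorsion e' x = frameTorsion e x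
      - (fderiv ℝ l x (e 1 x) • Y x - fderiv ℝ l x (e 3 x) • A x)
      + frameComplex e x (fderiv ℝ l x (e 0 x) • Y x - fderiv ℝ l x (e 2 x) • A x) := by
  have hval : ∀ i, e' i x = e i x := by
    intro i
    fin_cases i <;> simp [h0, h1, h2, h3, hlx]
  have key : ∀ {B C : E → E}, DifferentiableAt ℝ B x → DifferentiableAt ℝ C x → ∀ w,
      fderiv ℝ (fun y => B y + l y • C y) x w = fderiv ℝ B x w + fderiv ℝ l x w • C x := by
    intro B C hB hC w
    rw [(hB.hasFDerivAt.fun_add (hl.hasFDerivAt.fun_smul hC.hasFDerivAt)).fderiv]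
    simp [hlx]
  have k1 : ∀ w, fderiv ℝ (e' 1) x w = fderiv ℝ (e 1) x w + fderiv ℝ l x w • A x := by
    rw [h1]; exact key he1 hA
  have k3 : ∀ w, fderiv ℝ (e' 3) x w = fderiv ℝ (e 3) x w + fderiv ℝ l x w • Y x := by
    rw [h3]; exact key he3 hY
  simp only [frameTorsion, frameComplex_congr hval, lieBracket, k1, k3, hval]
  rw [h0, h2]
  simp only [map_add, map_sub]
  abel

/-- The frame with the same first and third vector as `X`, the second one changed within
`span {X 0, X 1}` and the fourth one changed modulo `span {X 0, X 1}`. -/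
def adaptedFrame (X : Fin 4 → E → E) (a b u v : E → ℝ) : Fin 4 → E → E :=
  ![X 0, fun x => a x • X 0 x + b x • X 1 x, X 2,
    fun x => X 3 x + (u x • X 0 x + v x • X 1 x)]

variable {X : Fin 4 → E → E} {a b u v : E → ℝ}

theorem smoothNear_adaptedFrame (hX : ∀ i, SmoothNear (X i) p) (ha : SmoothNear a p)
    (hb : SmoothNear b p) (hu : SmoothNear u p) (hv : SmoothNear v p) (i : Fin 4) :
    SmoothNear (adaptedFrame X a b u v i) p := by
  fin_cases i
  · exact hX 0
  · exact (ha.smul (hX 0)).add (hb.smul (hX 1))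
  · exact hX 2
  · exact (hX 3).add ((hu.smul (hX 0)).add (hv.smul (hX 1)))

theorem IsFrameAt.adaptedFrame (h : IsFrameAt X x) (hb : b x ≠ 0) :
    IsFrameAt (adaptedFrame X a b u v) x := by
  refine .of_forall h.finrank_eq fun c hc => ?_
  have h1 := congrArg (coframe X x) hc
  simp only [_root_.adaptedFrame, Fin.sum_univ_four, map_add, map_smul, map_zero,
    Matrix.cons_val, h.coframe_frame] at h1
  have i0 := congrFun h1 0
  have i1 := congrFun h1 1
  have i2 := congrFun h1 2
  have i3 := congrFun h1 3
  simp at i0 i1 i2 i3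
  simp [i3, hb] at i0 i1
  simp [i1] at i0
  ext i
  fin_cases i <;> simp [i0, i1, i2, i3]

theorem span_adaptedFrame (hb : b x ≠ 0) :
    Submodule.span ℝ {adaptedFrame X a b u v 0 x, adaptedFrame X a b u v 1 x} =
      Submodule.span ℝ {X 0 x, X 1 x} := by
  apply le_antisymm <;> rw [Submodule.span_le, Set.insert_subset_iff, Set.singleton_subset_iff] <;>
    simp only [SetLike.mem_coe, Submodule.mem_span_pair, adaptedFrame, Matrix.cons_val]
  · exact ⟨⟨1, 0, by simp⟩, ⟨a x, b x, rfl⟩⟩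
  · refine ⟨⟨1, 0, by simp⟩, ⟨-(a x / b x), 1 / b x, ?_⟩⟩
    match_scalars <;> field_simp
    ring

/-- Modulo the span of X₀, X₁ the adapted frame still has X₂, X₃ as its last two vectors, so the
induced structure on the quotient does not depend on a, b, u, v. -/
theorem coframe_frameComplex_adaptedFrame (h : IsFrameAt X x) (hb : b x ≠ 0) (w : E) :
    coframe X x (frameComplex (adaptedFrame X a b u v) x w) 2 = -coframe X x w 3 ∧
      coframe X x (frameComplex (adaptedFrame X a b u v) x w) 3 = coframe X x w 2 := by
  have h' : IsFrameAt (adaptedFrame X a b u v) x := h.adaptedFrame hb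
  have hw := h'.sum_coframe w
  rw [frameComplex_eq]
  set c := coframe (adaptedFrame X a b u v) x w
  rw [← hw]
  simp [Fin.sum_univ_four, adaptedFrame, h.coframe_frame]

/-! ### Structure functions and the torsion condition -/

/-- The components of the bracket `[X i, X k]` in the frame `X`. -/
def structureFun (X : Fin 4 → E → E) (i k l : Fin 4) (x : E) : ℝ :=
  coframe X x (lieBracket ℝ (X i) (X k) x) l

/-- Real part of the `(0,1)`-derivative of the complex structure `X 2 ↦ X 3` along `X i`. -/
def slopeRe (X : Fin 4 → E → E) (i : Fin 4) (x : E) : ℝ :=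
  structureFun X i 3 2 x + structureFun X i 2 3 x

/-- Imaginary part of the `(0,1)`-derivative of the complex structure `X 2 ↦ X 3` along `X i`. -/
def slopeIm (X : Fin 4 → E → E) (i : Fin 4) (x : E) : ℝ :=
  structureFun X i 3 3 x - structureFun X i 2 2 x

theorem smoothNear_structureFun (hX : ∀ i, SmoothNear (X i) p) (h : IsFrameAt X p)
    (i k l : Fin 4) : SmoothNear (structureFun X i k l) p :=
  ((smoothNear_coframe hX h).clm_apply ((hX i).lieBracket (hX k))).proj l

theorem smoothNear_slopeRe (hX : ∀ i, SmoothNear (X i) p) (h : IsFrameAt X p) (i : Fin 4) :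
    SmoothNear (slopeRe X i) p :=
  (smoothNear_structureFun hX h _ _ _).add (smoothNear_structureFun hX h _ _ _)

theorem smoothNear_slopeIm (hX : ∀ i, SmoothNear (X i) p) (h : IsFrameAt X p) (i : Fin 4) :
    SmoothNear (slopeIm X i) p :=
  (smoothNear_structureFun hX h _ _ _).sub (smoothNear_structureFun hX h _ _ _)

/-- Derivatives of a, b, u, v only multiply X₀ and X₁, so modulo their span the torsion is algebraic
in these functions. The two hypotheses are the vanishing of its components along X₂ and X₃. -/
theorem frameTorsion_adaptedFrame_mem (h : IsFrameAt X x) (hX : ∀ i, DifferentiableAt ℝ (X i) x)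
    (ha : DifferentiableAt ℝ a x) (hb : DifferentiableAt ℝ b x) (hu : DifferentiableAt ℝ u x)
    (hv : DifferentiableAt ℝ v x) (hbx : b x ≠ 0)
    (hre : -a x * (slopeRe X 0 x + v x * structureFun X 0 1 2 x)
        - (slopeIm X 0 x + v x * structureFun X 0 1 3 x)
      = b x * (slopeRe X 1 x - u x * structureFun X 0 1 2 x))
    (him : (slopeRe X 0 x + v x * structureFun X 0 1 2 x)
        - a x * (slopeIm X 0 x + v x * structureFun X 0 1 3 x)
      = b x * (slopeIm X 1 x - u x * structureFun X 0 1 3 x)) :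
    frameTorsion (adaptedFrame X a b u v) x ∈ Submodule.span ℝ {X 0 x, X 1 x} := by
  have hr : ∀ Z : E → E, lieBracket ℝ Z (fun x => X 3 x + (u x • X 0 x + v x • X 1 x)) x =
      lieBracket ℝ Z (X 3) x + (fderiv ℝ u x (Z x) • X 0 x + u x • lieBracket ℝ Z (X 0) x
        + (fderiv ℝ v x (Z x) • X 1 x + v x • lieBracket ℝ Z (X 1) x)) := by
    intro Z
    rw [← lieBracket_combination_right hu hv (hX 0) (hX 1)]
    exact lieBracket_add_right (hX 3) ((hu.smul (hX 0)).add (hv.smul (hX 1)))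
  have hl : ∀ Z : E → E, lieBracket ℝ (fun x => a x • X 0 x + b x • X 1 x) Z x = _ := fun Z =>
    lieBracket_combination_left ha hb (hX 0) (hX 1)
  have h10 : lieBracket ℝ (X 1) (X 0) x = -lieBracket ℝ (X 0) (X 1) x := lieBracket_swap
  obtain ⟨c2, c3⟩ := coframe_frameComplex_adaptedFrame (a := a) (u := u) (v := v) h hbx
    (lieBracket ℝ (adaptedFrame X a b u v 1) (adaptedFrame X a b u v 2) x
      + lieBracket ℝ (adaptedFrame X a b u v 0) (adaptedFrame X a b u v 3) x)
  rw [h.mem_span_iff, frameTorsion, map_add, Pi.add_apply, Pi.add_apply, c2, c3]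
  simp only [adaptedFrame, Matrix.cons_val, hr]
  simp only [hl]
  simp only [lieBracket_self, h10, slopeRe, slopeIm, structureFun, Pi.zero_apply] at hre him ⊢
  simp [h.coframe_frame]
  constructor <;> linarith

end

noncomputable section

variable {E : Type*} [NormedAddCommGroup E] [NormedSpace ℝ E]
variable {e : Fin 4 → E → E} {p x : E} {X : Fin 4 → E → E} {a b u v : E → ℝ}

open VectorField

/-- The distribution `D` is, near `p`, the image of the Nijenhuis tensor of some almost complex
structure. -/
def IsNijenhuisImageNear (D : E → Submodule ℝ E) (U : Set E) (p : E) : Prop :=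
  ∃ V : Set E, IsOpen V ∧ p ∈ V ∧ V ⊆ U ∧ ∃ j : E → E →L[ℝ] E,
    IsAlmostComplexOn j V ∧ ∀ x ∈ V, nijenhuisImage j x = (D x : Set E)

theorem isNijenhuisImageNear_of_adaptedFrame {D : E → Submodule ℝ E} {U : Set E} (hU : IsOpen U)
    (hp : p ∈ U) (hX : ∀ i, SmoothNear (X i) p) (h : IsFrameAt X p)
    (hD : ∀ᶠ x in 𝓝 p, Submodule.span ℝ {X 0 x, X 1 x} = D x)
    (ha : SmoothNear a p) (hb : SmoothNear b p) (hu : SmoothNear u p) (hv : SmoothNear v p)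
    (hbp : b p ≠ 0)
    (heq : ∀ᶠ x in 𝓝 p,
      -a x * (slopeRe X 0 x + v x * structureFun X 0 1 2 x)
          - (slopeIm X 0 x + v x * structureFun X 0 1 3 x)
        = b x * (slopeRe X 1 x - u x * structureFun X 0 1 2 x) ∧
      (slopeRe X 0 x + v x * structureFun X 0 1 2 x)
          - a x * (slopeIm X 0 x + v x * structureFun X 0 1 3 x)
        = b x * (slopeIm X 1 x - u x * structureFun X 0 1 3 x))
    (h0 : frameTorsion (adaptedFrame X a b u v) p ≠ 0) :
    IsNijenhuisImageNear D U p := by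
  have hbne := hb.continuousAt.eventually_ne hbp
  refine exists_almostComplex_of_frame hU hp (smoothNear_adaptedFrame hX ha hb hu hv)
    (h.adaptedFrame hbp) ?_ ?_ h0
  · filter_upwards [hD, hbne] with x h1 h2
    rw [span_adaptedFrame h2, h1]
  · filter_upwards [hD, hbne, heq, h.eventually hX,
      Filter.eventually_all.2 fun i => (hX i).eventually_differentiableAt,
      ha.eventually_differentiableAt, hb.eventually_differentiableAt,
      hu.eventually_differentiableAt, hv.eventually_differentiableAt]
      with x h1 h2 h3 h4 h5 h6 h7 h8 h9
    rw [← h1]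
    exact frameTorsion_adaptedFrame_mem h4 h5 h6 h7 h8 h9 h2 h3.1 h3.2

/-! ### Linear functions vanishing at a point -/

/-- The affine function vanishing at `p` whose derivative is the `i`-th coordinate in the
frame `X` at `p`. -/
def affineCoord (X : Fin 4 → E → E) (p : E) (i : Fin 4) (x : E) : ℝ := coframe X p (x - p) i

theorem contDiff_affineCoord (i : Fin 4) : ContDiff ℝ ∞ (affineCoord X p i) :=
  contDiff_pi.1 ((coframe X p).contDiff.comp (contDiff_id.sub contDiff_const)) i

theorem affineCoord_self (i : Fin 4) : affineCoord X p i p = 0 := by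
  simp [affineCoord]

theorem fderiv_affineCoord (i : Fin 4) (w : E) :
    fderiv ℝ (affineCoord X p i) p w = coframe X p w i := by
  have h1 : HasFDerivAt (fun x => coframe X p (x - p)) (coframe X p) p := by
    simpa using (coframe X p).hasFDerivAt.comp p ((hasFDerivAt_id p).sub_const p)
  have h2 := hasFDerivAt_pi'.1 h1 i
  have h3 : HasFDerivAt (affineCoord X p i) _ p := h2
  rw [h3.fderiv]
  rfl

/-! ### Distributions with `[D, D] ⊄ D` -/

/-- Here s = 1 and b = 1, so the equation is linear in u, v and solvable for any a. The freedom in a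
is spent on making the torsion nonzero at p. -/
theorem isNijenhuisImageNear_of_lieBracket_eq {D : E → Submodule ℝ E} {U : Set E} (hU : IsOpen U)
    (hp : p ∈ U) (hX : ∀ i, SmoothNear (X i) p) (h : IsFrameAt X p)
    (hD : ∀ᶠ x in 𝓝 p, Submodule.span ℝ {X 0 x, X 1 x} = D x)
    (h01 : X 2 = lieBracket ℝ (X 0) (X 1)) :
    IsNijenhuisImageNear D U p := by
  set p0 := slopeRe X 0
  set q0 := slopeIm X 0
  set p1 := slopeRe X 1
  set q1 := slopeIm X 1
  have sp0 : SmoothNear p0 p := smoothNear_slopeRe hX h 0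
  have sq0 : SmoothNear q0 p := smoothNear_slopeIm hX h 0
  have sp1 : SmoothNear p1 p := smoothNear_slopeRe hX h 1
  have sq1 : SmoothNear q1 p := smoothNear_slopeIm hX h 1
  -- The imaginary part of the equation gives v, and then the real part gives u.
  let v : (E → ℝ) → E → ℝ := fun a x => q1 x - p0 x + a x * q0 x
  let u : (E → ℝ) → E → ℝ := fun a x => p1 x + q0 x + a x * (p0 x + v a x)
  have sv : ∀ a, SmoothNear a p → SmoothNear (v a) p := fun a ha =>
    (sq1.sub sp0).add (ha.mul sq0)
  have su : ∀ a, SmoothNear a p → SmoothNear (u a) p := fun a ha =>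
    (sp1.add sq0).add (ha.mul (sp0.add (sv a ha)))
  have one : SmoothNear (fun _ : E => (1 : ℝ)) p := .const 1
  have zero : SmoothNear (fun _ : E => (0 : ℝ)) p := .const 0
  have main : ∀ a, SmoothNear a p →
      frameTorsion (adaptedFrame X a (fun _ => 1) (u a) (v a)) p ≠ 0 →
      IsNijenhuisImageNear D U p := by
    intro a ha hne
    refine isNijenhuisImageNear_of_adaptedFrame hU hp hX h hD ha one (su a ha) (sv a ha)
      one_ne_zero ?_ hne
    filter_upwards [h.eventually hX] with x hx
    have s2 : structureFun X 0 1 2 x = 1 := by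
      simp [structureFun, ← h01, hx.coframe_frame]
    have s3 : structureFun X 0 1 3 x = 0 := by
      simp [structureFun, ← h01, hx.coframe_frame]
    rw [s2, s3]
    constructor <;> simp only [u, v, p0, q0, p1, q1] <;> ring
  by_contra hcon
  -- At p the differential of l is 1 on the fourth frame vector and 0 on the others, so passing from
  -- a = 0 to a = l changes the torsion by exactly X₀(p).
  set l := affineCoord X p 3
  have sl : SmoothNear l p := .of_contDiff (contDiff_affineCoord 3)
  have t0 : frameTorsion (adaptedFrame X (fun _ => 0) (fun _ => 1) (u fun _ => 0) (v fun _ => 0)) p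
      = 0 := by
    by_contra hne
    exact hcon (main _ zero hne)
  have t1 : frameTorsion (adaptedFrame X l (fun _ => 1) (u l) (v l)) p = 0 := by
    by_contra hne
    exact hcon (main _ sl hne)
  have hs := smoothNear_adaptedFrame hX zero one (su _ zero) (sv _ zero)
  have hY : SmoothNear (fun x => (p0 x + v l x) • X 0 x + q0 x • X 1 x) p :=
    ((sp0.add (sv l sl)).smul (hX 0)).add (sq0.smul (hX 1))
  have key := frameTorsion_perturb (e' := adaptedFrame X l (fun _ => 1) (u l) (v l)) (l := l)
    (A := X 0) (Y := fun x => (p0 x + v l x) • X 0 x + q0 x • X 1 x)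
    (hs 1).differentiableAt (hs 3).differentiableAt sl.differentiableAt (hX 0).differentiableAt
    hY.differentiableAt (affineCoord_self 3) rfl
    (by
      funext y
      simp [adaptedFrame, add_comm])
    rfl
    (by
      funext y
      simp only [adaptedFrame, Matrix.cons_val, u, v]
      module)
  rw [t0, t1] at key
  simp [adaptedFrame, l, fderiv_affineCoord, h.coframe_frame] at key
  have h2 := h.coframe_frame 0
  rw [← key, map_zero] at h2
  simpa using congrFun h2 0

/-! ### Involutive distributions -/

/-- With s = 0 the equation says that the real-linear map Xₖ ↦ σₖ from Π to ℂ intertwines j with i.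
The normalisation σ₀ = 1, σ₁ = i at p makes this map invertible near p, which fixes j on Π. -/
theorem isNijenhuisImageNear_of_slopes {D : E → Submodule ℝ E} {U : Set E} (hU : IsOpen U)
    (hp : p ∈ U) (hX : ∀ i, SmoothNear (X i) p) (h : IsFrameAt X p)
    (hD : ∀ᶠ x in 𝓝 p, Submodule.span ℝ {X 0 x, X 1 x} = D x)
    (hinv : ∀ᶠ x in 𝓝 p, lieBracket ℝ (X 0) (X 1) x ∈ D x)
    (hp0 : slopeRe X 0 p = 1) (hq0 : slopeIm X 0 p = 0)
    (hp1 : slopeRe X 1 p = 0) (hq1 : slopeIm X 1 p = 1) :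
    IsNijenhuisImageNear D U p := by
  set p0 := slopeRe X 0
  set q0 := slopeIm X 0
  set p1 := slopeRe X 1
  set q1 := slopeIm X 1
  have sp0 : SmoothNear p0 p := smoothNear_slopeRe hX h 0
  have sq0 : SmoothNear q0 p := smoothNear_slopeIm hX h 0
  have sp1 : SmoothNear p1 p := smoothNear_slopeRe hX h 1
  have sq1 : SmoothNear q1 p := smoothNear_slopeIm hX h 1
  let d : E → ℝ := fun x => p0 x * q1 x - p1 x * q0 x
  have sd : SmoothNear d p := (sp0.mul sq1).sub (sp1.mul sq0)
  have hd : d p ≠ 0 := by simp [d, hp0, hq0, hp1, hq1]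
  -- These are the coefficients with aσ₀ + bσ₁ = iσ₀; d = Im(σ̄₀σ₁) is the determinant of the
  -- system.
  let a : E → ℝ := fun x => -(p0 x * p1 x + q0 x * q1 x) / d x
  let b : E → ℝ := fun x => (p0 x * p0 x + q0 x * q0 x) / d x
  have sa : SmoothNear a p := ((sp0.mul sp1).add (sq0.mul sq1)).neg.div sd hd
  have sb : SmoothNear b p := ((sp0.mul sp0).add (sq0.mul sq0)).div sd hd
  have hbp : b p ≠ 0 := by simp [b, d, hp0, hq0, hp1, hq1]
  have zero : SmoothNear (fun _ : E => (0 : ℝ)) p := .const 0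
  have main : ∀ u, SmoothNear u p →
      frameTorsion (adaptedFrame X a b u fun _ => 0) p ≠ 0 → IsNijenhuisImageNear D U p := by
    intro u su hne
    refine isNijenhuisImageNear_of_adaptedFrame hU hp hX h hD sa sb su zero hbp ?_ hne
    filter_upwards [h.eventually hX, hD, hinv, sd.continuousAt.eventually_ne hd]
      with x h1 h2 h3 h4
    rw [← h2, h1.mem_span_iff] at h3
    have s2 : structureFun X 0 1 2 x = 0 := h3.1
    have s3 : structureFun X 0 1 3 x = 0 := h3.2
    rw [s2, s3]
    constructor
    · simp only [a, b]
      field_simp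
      simp only [d, p0, q0, p1, q1]
      ring
    · simp only [a, b]
      field_simp
      simp only [d, p0, q0, p1, q1]
      ring
  by_contra hcon
  -- Passing from u = 0 to u = l adds -a(p) X₀ + jX₀ to the torsion at p, and jX₀ = aX₀ + bX₁ has
  -- nonzero X₁-component b(p).
  set l := affineCoord X p 0
  have sl : SmoothNear l p := .of_contDiff (contDiff_affineCoord 0)
  have t0 : frameTorsion (adaptedFrame X a b (fun _ => 0) fun _ => 0) p = 0 := by
    by_contra hne
    exact hcon (main _ zero hne)
  have t1 : frameTorsion (adaptedFrame X a b l fun _ => 0) p = 0 := by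
    by_contra hne
    exact hcon (main _ sl hne)
  have hs := smoothNear_adaptedFrame hX sa sb zero zero
  have key := frameTorsion_perturb (e' := adaptedFrame X a b l fun _ => 0) (l := l)
    (A := fun _ => 0) (Y := X 0)
    (hs 1).differentiableAt (hs 3).differentiableAt sl.differentiableAt
    (differentiableAt_const 0) (hX 0).differentiableAt (affineCoord_self 0) rfl
    (by
      funext y
      simp [adaptedFrame])
    rfl
    (by
      funext y
      simp [adaptedFrame])
  have hj := (h.adaptedFrame (a := a) (u := fun _ => 0) (v := fun _ => 0) hbp).frameComplex_frame.1
  have hl0 : fderiv ℝ l p (adaptedFrame X a b (fun _ => 0) (fun _ => 0) 0 p) = 1 := by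
    simp [l, fderiv_affineCoord, adaptedFrame, h.coframe_frame]
  rw [t0, t1, hl0, one_smul, smul_zero, smul_zero, sub_zero, sub_zero] at key
  have hj' : frameComplex (adaptedFrame X a b (fun _ => 0) fun _ => 0) p (X 0 p)
      = a p • X 0 p + b p • X 1 p := hj
  rw [hj'] at key
  have h2 := congrFun (congrArg (coframe X p) key) 1
  simp [h.coframe_frame] at h2
  exact hbp h2.symm

/-- The slopes at p depend on the first derivatives of the fourth field along X₀ and X₁, which can
be prescribed freely without changing its value at p. -/
theorem isNijenhuisImageNear_of_involutive {D : E → Submodule ℝ E} {U : Set E} (hU : IsOpen U)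
    (hp : p ∈ U) {X₀ X₁ : E → E} (hX₀ : SmoothNear X₀ p) (hX₁ : SmoothNear X₁ p) {v₂ v₃ : E}
    (h : IsFrameAt ![X₀, X₁, fun _ => v₂, fun _ => v₃] p)
    (hD : ∀ᶠ x in 𝓝 p, Submodule.span ℝ {X₀ x, X₁ x} = D x)
    (hinv : ∀ᶠ x in 𝓝 p, lieBracket ℝ X₀ X₁ x ∈ D x) :
    IsNijenhuisImageNear D U p := by
  set Z : Fin 4 → E → E := ![X₀, X₁, fun _ => v₂, fun _ => v₃]
  set c := coframe Z p
  have c0 : c (X₀ p) = Pi.single 0 1 := h.coframe_frame 0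
  have c1 : c (X₁ p) = Pi.single 1 1 := h.coframe_frame 1
  have c2 : c v₂ = Pi.single 2 1 := h.coframe_frame 2
  have c3 : c v₃ = Pi.single 3 1 := h.coframe_frame 3
  let y₀ := fderiv ℝ X₀ p v₂
  let y₁ := fderiv ℝ X₁ p v₂
  -- The values wanted for [X₀, Y] and [X₁, Y] at p. As [Xₖ, v₂] = -yₖ there, they give σ₀ = 1 and
  -- σ₁ = i; w₀, w₁ are the derivatives of Y that produce them.
  let s₀ := (1 + c y₀ 3) • v₂ - c y₀ 2 • v₃
  let s₁ := c y₁ 3 • v₂ + (1 - c y₁ 2) • v₃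
  let w₀ := fderiv ℝ X₀ p v₃ + s₀
  let w₁ := fderiv ℝ X₁ p v₃ + s₁
  let Y : E → E := fun x => v₃ + (affineCoord Z p 0 x • w₀ + affineCoord Z p 1 x • w₁)
  have hYc : ContDiff ℝ ∞ Y := contDiff_const.add
    (((contDiff_affineCoord 0).smul contDiff_const).add
      ((contDiff_affineCoord 1).smul contDiff_const))
  have hYp : Y p = v₃ := by simp [Y, affineCoord_self]
  have hYd : ∀ w, fderiv ℝ Y p w = c w 0 • w₀ + c w 1 • w₁ := by
    intro w
    have d0 : DifferentiableAt ℝ (affineCoord Z p 0) p :=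
      (contDiff_affineCoord 0).differentiable (by simp) p
    have d1 : DifferentiableAt ℝ (affineCoord Z p 1) p :=
      (contDiff_affineCoord 1).differentiable (by simp) p
    have := ((d0.hasFDerivAt.fun_smul (hasFDerivAt_const w₀ p)).fun_add
      (d1.hasFDerivAt.fun_smul (hasFDerivAt_const w₁ p))).const_add v₃
    rw [this.fderiv]
    simp [fderiv_affineCoord, c]
  have hval : ∀ i, (![X₀, X₁, fun _ => v₂, Y] : Fin 4 → E → E) i p = Z i p := by
    intro i
    fin_cases i <;> simp [Z, hYp]
  have hc : coframe ![X₀, X₁, fun _ => v₂, Y] p = c := coframe_congr hval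
  have hfr : IsFrameAt ![X₀, X₁, fun _ => v₂, Y] p := by
    rw [IsFrameAt, frameMap_congr hval]; exact h
  refine isNijenhuisImageNear_of_slopes (X := ![X₀, X₁, fun _ => v₂, Y]) hU hp ?_ hfr hD hinv
    ?_ ?_ ?_ ?_
  · intro i
    fin_cases i
    · exact hX₀
    · exact hX₁
    · exact .const v₂
    · exact .of_contDiff hYc
  all_goals
    simp [slopeRe, slopeIm, structureFun, hc, lieBracket, hYd, hYp, c0, c1, w₀, w₁, s₀, s₁, c2,
      c3, y₀, y₁]

end

noncomputable section

variable {E : Type*} [NormedAddCommGroup E] [NormedSpace ℝ E]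
variable {p x : E} {D : E → Submodule ℝ E} {X₀ X₁ : E → E}

open VectorField

/-! ### Derived flags of rank two distributions -/

theorem mem_localSections {Y : E → E} (hY : SmoothNear Y x) (hYD : ∀ᶠ y in 𝓝 x, Y y ∈ D y) :
    Y ∈ localSections D x :=
  hY.and hYD

theorem derivedFlag_zero_le_one : derivedFlag D 0 x ≤ derivedFlag D 1 x :=
  Submodule.map_mono le_sup_left

theorem lieBracket_mem_derivedFlag_one {Y Z : E → E} (hY : Y ∈ localSections D x)
    (hZ : Z ∈ localSections D x) : lieBracket ℝ Y Z x ∈ derivedFlag D 1 x :=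
  ⟨lieBracket ℝ Y Z, Submodule.mem_sup_right (Submodule.subset_span ⟨Y, hY, Z, hZ, rfl⟩), rfl⟩

theorem eventually_mem_of_span (hD : ∀ᶠ y in 𝓝 x, Submodule.span ℝ {X₀ y, X₁ y} = D y) :
    (∀ᶠ y in 𝓝 x, X₀ y ∈ D y) ∧ ∀ᶠ y in 𝓝 x, X₁ y ∈ D y :=
  ⟨hD.mono fun y hy => hy ▸ Submodule.subset_span (by simp),
    hD.mono fun y hy => hy ▸ Submodule.subset_span (by simp)⟩

theorem le_derivedFlag_zero (hX₀ : SmoothNear X₀ x) (hX₁ : SmoothNear X₁ x)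
    (hD : ∀ᶠ y in 𝓝 x, Submodule.span ℝ {X₀ y, X₁ y} = D y) : D x ≤ derivedFlag D 0 x := by
  obtain ⟨m₀, m₁⟩ := eventually_mem_of_span hD
  rw [← hD.self_of_nhds, Submodule.span_le, Set.insert_subset_iff, Set.singleton_subset_iff]
  exact ⟨⟨X₀, mem_localSections hX₀ m₀, rfl⟩, ⟨X₁, mem_localSections hX₁ m₁, rfl⟩⟩

/-- A local section is a combination of the members of a frame, with smooth coefficients. -/
theorem exists_coeff_of_mem_localSections {X : Fin 4 → E → E} (hX : ∀ i, SmoothNear (X i) x)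
    (h : IsFrameAt X x) (hD : ∀ᶠ y in 𝓝 x, Submodule.span ℝ {X 0 y, X 1 y} = D y) {Y : E → E}
    (hY : Y ∈ localSections D x) :
    ∃ a b : E → ℝ, SmoothNear a x ∧ SmoothNear b x ∧
      Y =ᶠ[𝓝 x] fun y => a y • X 0 y + b y • X 1 y := by
  have sY : SmoothNear Y x := Filter.Eventually.mono hY fun y hy => hy.1
  have sc := (smoothNear_coframe hX h).clm_apply sY
  refine ⟨fun y => coframe X y (Y y) 0, fun y => coframe X y (Y y) 1, sc.proj 0, sc.proj 1, ?_⟩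
  have hm : ∀ᶠ y in 𝓝 x, Y y ∈ D y := Filter.Eventually.mono hY fun y hy => hy.2
  filter_upwards [hm, hD, h.eventually hX] with y h1 h2 h3
  rw [← h2, h3.mem_span_iff] at h1
  conv_lhs => rw [← h3.sum_coframe (Y y)]
  simp [Fin.sum_univ_four, h1.1, h1.2]

/-- Expanding brackets of sections in the frame leaves terms in X₀, X₁ and multiples of [X₀, X₁], so
involutivity is needed only at the point itself. -/
theorem derivedFlag_one_le {X : Fin 4 → E → E} (hX : ∀ i, SmoothNear (X i) x)
    (h : IsFrameAt X x) (hD : ∀ᶠ y in 𝓝 x, Submodule.span ℝ {X 0 y, X 1 y} = D y)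
    (h01 : lieBracket ℝ (X 0) (X 1) x ∈ D x) : derivedFlag D 1 x ≤ D x := by
  have m₀ := (eventually_mem_of_span hD).1.self_of_nhds
  have m₁ := (eventually_mem_of_span hD).2.self_of_nhds
  have h10 : lieBracket ℝ (X 1) (X 0) x ∈ D x := by
    rw [lieBracket_swap]; exact (D x).neg_mem h01
  rw [derivedFlag, Submodule.map_le_iff_le_comap, derivedSections, sup_le_iff, Submodule.span_le]
  constructor
  · intro Y hY
    exact (Filter.Eventually.self_of_nhds hY).2
  · rintro _ ⟨Y, hY, Z, hZ, rfl⟩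
    obtain ⟨a, b, ha, hb, hYe⟩ := exists_coeff_of_mem_localSections hX h hD hY
    obtain ⟨c, d, hc, hd, hZe⟩ := exists_coeff_of_mem_localSections hX h hD hZ
    change lieBracket ℝ Y Z x ∈ D x
    rw [hYe.lieBracket_vectorField_eq hZe,
      lieBracket_combination_left ha.differentiableAt hb.differentiableAt
        (hX 0).differentiableAt (hX 1).differentiableAt,
      lieBracket_combination_right hc.differentiableAt hd.differentiableAt
        (hX 0).differentiableAt (hX 1).differentiableAt,
      lieBracket_combination_right hc.differentiableAt hd.differentiableAt
        (hX 0).differentiableAt (hX 1).differentiableAt]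
    simp only [lieBracket_self, Pi.zero_apply, smul_zero, add_zero]
    have s : ∀ (t : ℝ) {w : E}, w ∈ D x → t • w ∈ D x := fun t w hw => (D x).smul_mem t hw
    refine add_mem (add_mem (s _ m₀) (s _ (add_mem (s _ m₀) (add_mem (s _ m₁) (s _ h01)))))
      (add_mem (s _ m₁) (s _ (add_mem (add_mem (s _ m₀) (s _ h10)) (s _ m₁))))

/-- A regular rank two distribution that is involutive at a point is involutive near it. -/
theorem eventually_lieBracket_mem [FiniteDimensional ℝ E] {U : Set E}
    (hreg : IsRegularDistributionOn D U) (hp : p ∈ U)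
    {X : Fin 4 → E → E} (hX : ∀ i, SmoothNear (X i) p) (h : IsFrameAt X p)
    (hD : ∀ᶠ y in 𝓝 p, Submodule.span ℝ {X 0 y, X 1 y} = D y)
    (hrank : ∀ᶠ y in 𝓝 p, Module.finrank ℝ (D y) = 2)
    (h01 : lieBracket ℝ (X 0) (X 1) p ∈ D p) :
    ∀ᶠ y in 𝓝 p, lieBracket ℝ (X 0) (X 1) y ∈ D y := by
  obtain ⟨V, hV, hpV, -, hVk⟩ := hreg p hp
  filter_upwards [hV.mem_nhds hpV, hrank, (hX 0).eventually, (hX 1).eventually,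
    eventually_eventually_nhds.2 hD] with y hy hr s₀ s₁ hDy
  have hle : D y ≤ derivedFlag D 1 y :=
    (le_derivedFlag_zero s₀ s₁ hDy).trans derivedFlag_zero_le_one
  -- The first derived rank is at most 2 at p, hence at y by regularity; as the derived space
  -- contains Π at y, the two coincide.
  have hfin : Module.finrank ℝ (derivedFlag D 1 y) ≤ Module.finrank ℝ (D y) := by
    rw [hVk 1 y hy, hr, ← hrank.self_of_nhds]
    exact Submodule.finrank_mono (derivedFlag_one_le hX h hD h01)
  rw [Submodule.eq_of_le_of_finrank_le hle hfin]
  obtain ⟨m₀, m₁⟩ := eventually_mem_of_span hDy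
  exact lieBracket_mem_derivedFlag_one (mem_localSections s₀ m₀) (mem_localSections s₁ m₁)

/-! ### Completing frames and splitting into cases -/

theorem exists_frame_of_linearIndependent (hE : Module.finrank ℝ E = 4) {X₂ : E → E}
    (h : LinearIndependent ℝ ![X₀ p, X₁ p, X₂ p]) :
    ∃ v₃ : E, IsFrameAt ![X₀, X₁, X₂, fun _ => v₃] p := by
  have : FiniteDimensional ℝ E := Module.finite_of_finrank_pos (by omega)
  obtain ⟨v₃, hv₃⟩ := exists_linearIndependent_snoc_of_lt_finrank h (by omega)
  have hsnoc : (Fin.snoc ![X₀ p, X₁ p, X₂ p] v₃ : Fin 4 → E) =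
      fun i => (![X₀, X₁, X₂, fun _ => v₃] : Fin 4 → E → E) i p := by
    funext i
    fin_cases i <;> rfl
  rw [hsnoc] at hv₃
  exact ⟨v₃, .of_linearIndependent hE hv₃⟩

/-- A regular rank two distribution on an open set of a four-dimensional space is locally the
image of a Nijenhuis tensor. -/
theorem isNijenhuisImageNear_of_regular (hE : Module.finrank ℝ E = 4) {U : Set E} (hU : IsOpen U)
    (hD : IsSmoothDistributionOn 2 D U) (hreg : IsRegularDistributionOn D U) (hp : p ∈ U) :
    IsNijenhuisImageNear D U p := by
  have : FiniteDimensional ℝ E := Module.finite_of_finrank_pos (by omega)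
  obtain ⟨V, hV, hpV, -, ξ, hξ, hspan⟩ := hD p hp
  have sξ : ∀ i, SmoothNear (ξ i) p := fun i => by
    filter_upwards [hV.mem_nhds hpV] with y hy using (hξ i).contDiffAt (hV.mem_nhds hy)
  have hrange : ∀ y, (Set.range fun i => ξ i y) = {ξ 0 y, ξ 1 y} := by
    intro y
    ext w
    simp [Fin.exists_fin_two, eq_comm]
  have hDp : ∀ᶠ y in 𝓝 p, Submodule.span ℝ {ξ 0 y, ξ 1 y} = D y := by
    filter_upwards [hV.mem_nhds hpV] with y hy
    rw [← hrange, (hspan y hy).2]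
  have hrank : ∀ᶠ y in 𝓝 p, Module.finrank ℝ (D y) = 2 := by
    filter_upwards [hV.mem_nhds hpV] with y hy
    rw [← (hspan y hy).2, finrank_span_eq_card (hspan y hy).1, Fintype.card_fin]
  have hsnoc : ∀ w : E, (Fin.snoc (fun i => ξ i p) w : Fin 3 → E) = ![ξ 0 p, ξ 1 p, w] := by
    intro w
    funext i
    fin_cases i <;> rfl
  -- Regularity enters only in the first case, to spread involutivity from p to a neighbourhood.
  by_cases h01 : lieBracket ℝ (ξ 0) (ξ 1) p ∈ D p
  · obtain ⟨v₂, hv₂⟩ := exists_linearIndependent_snoc_of_lt_finrank (hspan p hpV).1 (by omega)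
    rw [hsnoc] at hv₂
    obtain ⟨v₃, hv₃⟩ := exists_frame_of_linearIndependent (X₂ := fun _ => v₂) hE hv₂
    have sX : ∀ i, SmoothNear ((![ξ 0, ξ 1, fun _ => v₂, fun _ => v₃] : Fin 4 → E → E) i) p := by
      intro i
      fin_cases i
      · exact sξ 0
      · exact sξ 1
      · exact .const v₂
      · exact .const v₃
    exact isNijenhuisImageNear_of_involutive hU hp (sξ 0) (sξ 1) hv₃ hDp
      (eventually_lieBracket_mem hreg hp sX hv₃ hDp hrank h01)
  · have hli : LinearIndependent ℝ ![ξ 0 p, ξ 1 p, lieBracket ℝ (ξ 0) (ξ 1) p] := by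
      rw [← hsnoc, linearIndependent_finSnoc, (hspan p hpV).2]
      exact ⟨(hspan p hpV).1, h01⟩
    obtain ⟨v₃, hv₃⟩ := exists_frame_of_linearIndependent (X₂ := lieBracket ℝ (ξ 0) (ξ 1)) hE hli
    refine isNijenhuisImageNear_of_lieBracket_eq
      (X := ![ξ 0, ξ 1, lieBracket ℝ (ξ 0) (ξ 1), fun _ => v₃]) hU hp ?_ hv₃ hDp rfl
    intro i
    fin_cases i
    · exact sξ 0
    · exact sξ 1
    · exact (sξ 0).lieBracket (sξ 1)
    · exact .const v₃

end

theorem mainTheorem2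
    (U : Set (EuclideanSpace ℝ (Fin 4))) (hU : IsOpen U)
    (D : EuclideanSpace ℝ (Fin 4) → Submodule ℝ (EuclideanSpace ℝ (Fin 4)))
    (hD : IsSmoothDistributionOn 2 D U)
    (hreg : IsRegularDistributionOn D U)
    (p : EuclideanSpace ℝ (Fin 4)) (hp : p ∈ U) :
    ∃ V : Set (EuclideanSpace ℝ (Fin 4)), IsOpen V ∧ p ∈ V ∧ V ⊆ U ∧
      ∃ j : EuclideanSpace ℝ (Fin 4) →
          EuclideanSpace ℝ (Fin 4) →L[ℝ] EuclideanSpace ℝ (Fin 4),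
        IsAlmostComplexOn j V ∧
        ∀ x ∈ V, nijenhuisImage j x = (D x : Set (EuclideanSpace ℝ (Fin 4))) :=
  isNijenhuisImageNear_of_regular (by simp) hU hD hreg hp
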